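/- An argumentation framework $AF=(AR,Attacks)$ consists of a finite set $AR$ of arguments and a relation $Attacks\subseteq AR\times AR$; $a$ attacks $b$ if $(a,b)\in Attacks$, and a set $S\subseteq AR$ attacks $b$ if some $a\in S$ attacks $b$. Semantics. Let $S\subseteq AR$. $S$ is conflict-free if no element of $S$ attacks an element of $S$; $a\in AR$ is acceptable w.r.t. $S$ if $S$ attacks every attacker of $a$; $S$ is admissible if it is conflict-free and each of its elements is acceptable w.r.t. $S$. The range of $S$ is $S\cup S^+$ with $S^+=\{b\in AR: S\text{ attacks }b\}$. Maximality and minimality refer to inclusion. A set $S\subseteq AR$ is an extension of the following kind: - complete, if it is admissible and contains every argument acceptable w.r.t. $S$; - preferred, if it is maximal among admissible sets; - grounded, if it is minimal among complete extensions; - ideal, if it is maximal among the admissible sets contained in every preferred extension; - semi-stable, if it is complete and its range is maximal among the ranges of complete extensions; - eager, if it is maximal among the admissible sets contained in every semi-stable extension; - naive, if it is maximal among conflict-free sets; - stage, if it is conflict-free and its range is maximal among the ranges of conflict-free sets. An attack sequence is a sequence $\langle a_1,\dots,a_n\rangle$ in $AR$ ($n\ge 1$) in which $a_i$ attacks $a_{i+1}$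 for $1\le i\le n-1$ and $a_1,\dots,a_{n-1}$ are distinct; $b$ is reachable from $a$ if there is an attack sequence with $a_1=a$ and $a_n=b$. A strongly connected component (SCC) is a non-empty set of mutually reachable arguments such that no argument outside is mutually reachable with one inside; $SCCS_{AF}$ is the set of SCCs. The restriction $AF{\downarrow_X}$ is $(AR\cap X,Attacks\cap (X\times X))$. For an SCC $C$ and $S\subseteq AR$ let $D_{AF}(C,S)$ be the set of all $a\in C$ attacked by an element of $S\setminus C$, and $UP_{AF}(C,S)=C\setminus D_{AF}(C,S)$. A set $S\subseteq AR$ is a CF2 (resp. stage2) extension of $AF$ if either $|SCCS_{AF}|=1$ and $S$ is a naive (resp. stage) extension of $AF$, or $|SCCS_{AF}|\ne 1$ and, for all $C\in SCCS_{AF}$, $S\cap C$ is a CF2 (resp. stage2) extension of $AF{\downarrow_{UP_{AF}(C,S)}}$. For each of these kinds $x$, $\sigma_x(AF)$ denotes the set of all extensions of $AF$ of kind $x$. Expansions. An attack cycle of $AF$ is a sequence $\langle a_1,\dots,a_n\rangle$ in $AR$ with $n\ge2$, $a_i$ attacking $a_{i+1}$ for $1\le i\le n-1$, $a_1=a_n$,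 and $a_1,\dots,a_{n-1}$ distinct; $\mathcal C(AF)$ is the set of all attack cycles. $AF'=(AR',Attacks')$ is a rational man's expansion of $AF=(AR,Attacks)$, written $AF\preceq_{RM}AF'$, if $AR\subseteq AR'$ and $Attacks\subseteq Attacks'$ and 1. no $(a,b)\in Attacks'\setminus Attacks$ has both $a\in AR$ and $b\in AR$ (the expansion is normal); 2. $\mathcal C(AF')=\mathcal C(AF)$ (the expansion is non-cyclic); 3. whenever $a\in AR$, $b\in AR'\setminus AR$ and $b$ is reachable from $a$ in $AF'$, the argument $a$ occurs in no attack cycle of $AF'$. Proposition. Let $x\in\{$complete, preferred, semi-stable, stage, stage2, CF2, grounded, ideal, eager$\}$. For all argumentation frameworks $AF=(AR,Attacks)$ and $AF'=(AR',Attacks')$ with $AF\preceq_{RM}AF'$, $$\forall E\in\sigma_x(AF)\ \ \exists E'\in\sigma_x(AF')\ \text{ such that }\ E'\not\subseteq AR\ \lor\ E'=E .$$ -/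

import Mathlib

universe u

/-- An argumentation framework `(AR, Attacks)`: a finite set of arguments (drawn from the
ambient type `α`) together with a binary attack relation on it. -/
structure ArgFramework (α : Type u) where
  args : Set α
  finite_args : args.Finite
  attacks : α → α → Prop
  mem_of_attacks : ∀ {a b : α}, attacks a b → a ∈ args ∧ b ∈ args

/-- An argumentation semantics assigns to every framework a set of sets of arguments. -/
abbrev ArgSemantics (α : Type u) : Type u := ArgFramework α → Set (Set α)

namespace ArgFramework

variable {α : Type u}

/-- The set `S` attacks the argument `b`. -/
def SetAttacks (AF : ArgFramework α) (S : Set α) (b : α) : Prop :=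
  ∃ a ∈ S, AF.attacks a b

def ConflictFree (AF : ArgFramework α) (S : Set α) : Prop :=
  S ⊆ AF.args ∧ ∀ a ∈ S, ∀ b ∈ S, ¬ AF.attacks a b

/-- The argument `a` is acceptable with respect to `S`. -/
def Acceptable (AF : ArgFramework α) (S : Set α) (a : α) : Prop :=
  a ∈ AF.args ∧ ∀ b ∈ AF.args, AF.attacks b a → AF.SetAttacks S b

def Admissible (AF : ArgFramework α) (S : Set α) : Prop :=
  AF.ConflictFree S ∧ ∀ a ∈ S, AF.Acceptable S a

/-- The range `S ∪ S⁺` of a set of arguments. -/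
def range (AF : ArgFramework α) (S : Set α) : Set α :=
  S ∪ {b | b ∈ AF.args ∧ ∃ a ∈ S, AF.attacks a b}

/-! ### Semantics based on admissible sets -/

def complete : ArgSemantics α := fun AF =>
  {S | AF.Admissible S ∧ ∀ a ∈ AF.args, AF.Acceptable S a → a ∈ S}

def preferred : ArgSemantics α := fun AF =>
  {S | Maximal AF.Admissible S}

def grounded : ArgSemantics α := fun AF =>
  {S | Minimal (fun T => T ∈ complete AF) S}

/-- The maximal admissible set that is contained in every preferred extension. -/
def ideal : ArgSemantics α := fun AF =>
  {S | Maximal (fun T => AF.Admissible T ∧ ∀ P ∈ preferred AF, T ⊆ P) S}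

/-- Complete extensions whose range is maximal among the ranges of complete extensions. -/
def semiStable : ArgSemantics α := fun AF =>
  {S | MaximalFor (fun T => T ∈ complete AF) AF.range S}

/-- The maximal admissible set that is contained in every semi-stable extension. -/
def eager : ArgSemantics α := fun AF =>
  {S | Maximal (fun T => AF.Admissible T ∧ ∀ P ∈ semiStable AF, T ⊆ P) S}

/-! ### Semantics based on conflict-free sets -/

def naive : ArgSemantics α := fun AF =>
  {S | Maximal AF.ConflictFree S}

/-- Conflict-free sets whose range is maximal among the ranges of conflict-free sets. -/
def stage : ArgSemantics α := fun AF =>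
  {S | MaximalFor AF.ConflictFree AF.range S}

/-! ### Attack sequences, reachability, cycles -/

/-- `⟨a₁, …, aₙ⟩` (`n ≥ 1`) is an attack sequence: each argument attacks the next one and
`a₁, …, aₙ₋₁` are pairwise distinct. -/
def IsAttackSequence (AF : ArgFramework α) (l : List α) : Prop :=
  l ≠ [] ∧ (∀ x ∈ l, x ∈ AF.args) ∧ l.IsChain AF.attacks ∧ l.dropLast.Nodup

/-- `b` is reachable from `a`. Every argument is reachable from itself (`n = 1`). -/
def Reachable (AF : ArgFramework α) (a b : α) : Prop :=
  ∃ l : List α, AF.IsAttackSequence l ∧ l.head? = some a ∧ l.getLast? = some b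

/-- `⟨a₁, …, aₙ⟩` is an attack cycle: each argument attacks the next one, `a₁ = aₙ`, and exactly
`n - 1` different arguments occur. Hence `n ≥ 2`, and a self-attack is a cycle `⟨a, a⟩`. -/
def IsAttackCycle (AF : ArgFramework α) (l : List α) : Prop :=
  (∀ x ∈ l, x ∈ AF.args) ∧ l.IsChain AF.attacks ∧ l.head? = l.getLast? ∧
    {x | x ∈ l}.ncard + 1 = l.length

/-- The set of all attack cycles. -/
def cycles (AF : ArgFramework α) : Set (List α) := {l | AF.IsAttackCycle l}

/-! ### Strongly connected components and SCC-recursive semantics -/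

/-- The strongly connected components. -/
def sccs (AF : ArgFramework α) : Set (Set α) :=
  {S | S ⊆ AF.args ∧ S.Nonempty ∧
    (∀ a ∈ S, ∀ b ∈ S, AF.Reachable a b ∧ AF.Reachable b a) ∧
    ∀ a ∈ S, ¬ ∃ c ∈ AF.args \ S, AF.Reachable a c ∧ AF.Reachable c a}

/-- The restriction of a framework to a set of arguments. -/
def restrict (AF : ArgFramework α) (S : Set α) : ArgFramework α where
  args := AF.args ∩ S
  finite_args := AF.finite_args.inter_of_left S
  attacks a b := AF.attacks a b ∧ a ∈ S ∧ b ∈ S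
  mem_of_attacks h :=
    ⟨⟨(AF.mem_of_attacks h.1).1, h.2.1⟩, ⟨(AF.mem_of_attacks h.1).2, h.2.2⟩⟩

/-- The arguments outside `S` that attack `S`. -/
def outAttackers (AF : ArgFramework α) (S : Set α) : Set α :=
  {a | a ∈ AF.args ∧ a ∉ S ∧ ∃ b ∈ S, AF.attacks a b}

/-- The arguments that attack `a`. -/
def attackersOf (AF : ArgFramework α) (a : α) : Set α :=
  {b | b ∈ AF.args ∧ AF.attacks b a}

/-- The defeated arguments of the component `S`. -/
def sccD (AF : ArgFramework α) (S E : Set α) : Set α :=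
  {a | a ∈ S ∧ AF.SetAttacks (E ∩ AF.outAttackers S) a}

/-- The provisionally defeated arguments of the component `S`. -/
def sccP (AF : ArgFramework α) (S E : Set α) : Set α :=
  {a | a ∈ S ∧ ¬ AF.SetAttacks (E ∩ AF.outAttackers S) a ∧
    ∃ b ∈ AF.outAttackers S ∩ AF.attackersOf a, ¬ AF.SetAttacks E b}

/-- The undefeated arguments of the component `S`. -/
def sccU (AF : ArgFramework α) (S E : Set α) : Set α :=
  S \ (AF.sccD S E ∪ AF.sccP S E)

def sccUP (AF : ArgFramework α) (S E : Set α) : Set α :=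
  AF.sccU S E ∪ AF.sccP S E

/-- The extensions obtained from a base semantics by the recursive scheme for CF2 and stage2:
if there is exactly one strongly connected component, the extensions of the base semantics;
otherwise the sets `E` such that, for every component `C`, the set `E ∩ C` is an extension of the
restriction to `UP(C, E)`.  The recursion descends to frameworks with strictly fewer arguments,
so that this least solution of the recursive equation is its only one. -/
inductive SCCRecursive (base : ArgSemantics α) : ArgFramework α → Set α → Prop
  | single (AF : ArgFramework α) (E : Set α) (hE : E ⊆ AF.args) (h1 : AF.sccs.ncard = 1)
      (h : E ∈ base AF) : SCCRecursive base AF E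
  | many (AF : ArgFramework α) (E : Set α) (hE : E ⊆ AF.args) (h1 : AF.sccs.ncard ≠ 1)
      (h : ∀ C ∈ AF.sccs, SCCRecursive base (AF.restrict (AF.sccUP C E)) (E ∩ C)) :
      SCCRecursive base AF E

/-- The recursive equation. -/
theorem sccRecursive_iff (base : ArgSemantics α) (AF : ArgFramework α) (E : Set α) :
    SCCRecursive base AF E ↔ E ⊆ AF.args ∧
      ((AF.sccs.ncard = 1 ∧ E ∈ base AF) ∨ (AF.sccs.ncard ≠ 1 ∧
        ∀ C ∈ AF.sccs, SCCRecursive base (AF.restrict (AF.sccUP C E)) (E ∩ C))) := by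
  constructor
  · intro h
    cases h with
    | single _ _ hE h1 h => exact ⟨hE, Or.inl ⟨h1, h⟩⟩
    | many _ _ hE h1 h => exact ⟨hE, Or.inr ⟨h1, h⟩⟩
  · rintro ⟨hE, ⟨h1, h⟩ | ⟨h1, h⟩⟩
    · exact SCCRecursive.single AF E hE h1 h
    · exact SCCRecursive.many AF E hE h1 h

def cf2 : ArgSemantics α := fun AF => {E | SCCRecursive naive AF E}

def stage2 : ArgSemantics α := fun AF => {E | SCCRecursive stage AF E}

/-! ### Expansions -/

/-- `AF'` is an expansion of `AF`. -/
def Expansion (AF AF' : ArgFramework α) : Prop :=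
  AF.args ⊆ AF'.args ∧ ∀ a b, AF.attacks a b → AF'.attacks a b

/-- `AF'` is a normal expansion of `AF`: no attacks are added between old arguments. -/
def NormalExpansion (AF AF' : ArgFramework α) : Prop :=
  Expansion AF AF' ∧
    ¬ ∃ a b, (AF'.attacks a b ∧ ¬ AF.attacks a b) ∧ a ∈ AF.args ∧ b ∈ AF.args

/-- `AF'` is a non-cyclic expansion of `AF`: the attack cycles are the same. -/
def NonCyclicExpansion (AF AF' : ArgFramework α) : Prop :=
  Expansion AF AF' ∧ AF'.cycles = AF.cycles

/-- `AF'` is a rational man's expansion of `AF`. -/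
def RationalManExpansion (AF AF' : ArgFramework α) : Prop :=
  Expansion AF AF' ∧ NormalExpansion AF AF' ∧ NonCyclicExpansion AF AF' ∧
    ∀ a ∈ AF.args, ∀ b ∈ AF'.args \ AF.args, AF'.Reachable a b →
      ∀ C ∈ AF'.cycles, a ∉ C

end ArgFramework

namespace ArgFramework

variable {α : Type u}

open Relation

/-! Call an argument of `AF'` an ancestor if a new argument is reachable from it; new arguments are
themselves ancestors. Ancestors are closed under attackers and lie on no cycle: condition 3 excludes
the old ones from cycles, condition 2 the new ones (`not_transGen`). Hence induction along attacks
is available on them (`ancestors_induction`). There the extensions to be compared are conflict-free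
and attack each other's missing members, and by induction such sets coincide on all ancestors
(`mem_iff_mem`).

Every semantics in question has an extension `E'` of `AF'`. If `E'` has a new argument, nothing is
left to show. Otherwise `E'` attacks each new argument from an old ancestor, and that ancestor lies
in `E` too, so `E` attacks every new argument. The new arguments then have no influence, and `E`
remains an extension of `AF'`.

For the semantics based on complete extensions this yields `complete_eq` and its consequences. For
stage, `E'` must be chosen with a range containing that of `E`. For CF2 and stage2, components are
compared one by one: old components are unchanged, and new ones are singletons defeated by `E`. -/

@[ext]
theorem ext {AF BF : ArgFramework α} (h₁ : AF.args = BF.args)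
    (h₂ : ∀ a b, AF.attacks a b ↔ BF.attacks a b) : AF = BF := by
  obtain ⟨A, _, r, _⟩ := AF
  obtain ⟨B, _, s, _⟩ := BF
  obtain rfl : A = B := h₁
  obtain rfl : r = s := funext fun a => funext fun b => propext (h₂ a b)
  rfl

/-! ### Reachability -/

theorem mem_args_of_reflTransGen {AF : ArgFramework α} {a b : α} (ha : a ∈ AF.args)
    (h : ReflTransGen AF.attacks a b) : b ∈ AF.args := by
  induction h with
  | refl => exact ha
  | tail _ h _ => exact (AF.mem_of_attacks h).2

/-- A walk can be shortened to a path without repetitions. -/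
theorem exists_nodup_chain {AF : ArgFramework α} {a b : α} (hb : b ∈ AF.args)
    (h : ReflTransGen AF.attacks a b) :
    ∃ l : List α, (∀ x ∈ l, x ∈ AF.args) ∧ l.IsChain AF.attacks ∧ l.Nodup ∧
      l.head? = some a ∧ l.getLast? = some b := by
  induction h using ReflTransGen.head_induction_on with
  | refl => exact ⟨[b], by simpa using hb, by simp, by simp, rfl, rfl⟩
  | @head a c hac _ ih =>
    obtain ⟨l, hl, hch, hnd, hhd, hlast⟩ := ih
    by_cases ha : a ∈ l
    · obtain ⟨s, t, rfl⟩ := List.append_of_mem ha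
      refine ⟨a :: t, fun x hx => hl x (by simp_all), hch.right_of_append,
        (List.nodup_append.1 hnd).2.1, rfl, ?_⟩
      simpa using hlast
    · cases l with
      | nil => simp at hhd
      | cons d t =>
        obtain rfl : d = c := by simpa using hhd
        refine ⟨a :: d :: t, ?_, ?_, List.nodup_cons.2 ⟨ha, hnd⟩, rfl, ?_⟩
        · intro x hx
          rcases List.mem_cons.1 hx with rfl | hx
          · exact (AF.mem_of_attacks hac).1
          · exact hl x hx
        · exact List.isChain_cons_cons.2 ⟨hac, hch⟩
        · simpa using hlast

theorem reflTransGen_of_isChain {r : α → α → Prop} {l : List α} {a b : α} (h : l.IsChain r)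
    (ha : l.head? = some a) (hb : l.getLast? = some b) : ReflTransGen r a b := by
  induction l generalizing a with
  | nil => simp at ha
  | cons c t ih =>
    obtain rfl : c = a := by simpa using ha
    cases t with
    | nil =>
      obtain rfl : c = b := by simpa using hb
      exact .refl
    | cons d t =>
      rw [List.isChain_cons_cons] at h
      exact .head h.1 (ih h.2 rfl (by simpa using hb))

theorem reachable_iff {AF : ArgFramework α} {a b : α} :
    AF.Reachable a b ↔ a ∈ AF.args ∧ ReflTransGen AF.attacks a b := by
  constructor
  · rintro ⟨l, ⟨_, hl, hch, _⟩, ha, hb⟩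
    exact ⟨hl a (List.mem_of_head? ha), reflTransGen_of_isChain hch ha hb⟩
  · rintro ⟨ha, h⟩
    obtain ⟨l, hl, hch, hnd, hhd, hlast⟩ := exists_nodup_chain (mem_args_of_reflTransGen ha h) h
    refine ⟨l, ⟨?_, hl, hch, hnd.sublist (List.dropLast_sublist l)⟩, hhd, hlast⟩
    rintro rfl
    simp at hhd

theorem exists_cycle_of_transGen {AF : ArgFramework α} {a : α} (h : TransGen AF.attacks a a) :
    ∃ C ∈ AF.cycles, a ∈ C := by
  obtain ⟨c, hac, hca⟩ := TransGen.head'_iff.1 h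
  have ha := (AF.mem_of_attacks hac).1
  obtain ⟨l, hl, hch, hnd, hhd, hlast⟩ := exists_nodup_chain ha hca
  have hal : a ∈ l := List.mem_of_getLast? hlast
  cases l with
  | nil => simp at hhd
  | cons d t =>
    obtain rfl : d = c := by simpa using hhd
    refine ⟨a :: d :: t, ⟨?_, List.isChain_cons_cons.2 ⟨hac, hch⟩, ?_, ?_⟩, by simp⟩
    · intro x hx
      rcases List.mem_cons.1 hx with rfl | hx
      · exact ha
      · exact hl x hx
    · simpa using hlast.symm
    -- The prepended `a` is already the last entry of `d :: t`, so the distinct entries are exactly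
    -- those of `d :: t`.
    · classical
      have : {x | x ∈ a :: d :: t} = ((d :: t).toFinset : Set α) := by
        ext x
        simp only [Set.mem_ofPred_eq, List.coe_toFinset, List.mem_cons (a := x) (b := a)]
        exact ⟨fun h => h.elim (fun h => h ▸ hal) id, Or.inr⟩
      rw [this, Set.ncard_coe_finset, List.toFinset_card_of_nodup hnd]
      rfl

/-! ### Strongly connected components -/

/-- The strongly connected component of an argument. -/
def component (AF : ArgFramework α) (a : α) : Set α :=
  {x | x ∈ AF.args ∧ ReflTransGen AF.attacks a x ∧ ReflTransGen AF.attacks x a}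

theorem mem_component_self {AF : ArgFramework α} {a : α} (ha : a ∈ AF.args) :
    a ∈ AF.component a := ⟨ha, .refl, .refl⟩

theorem component_eq {AF : ArgFramework α} {a b : α} (h : b ∈ AF.component a) :
    AF.component b = AF.component a := by
  ext x
  exact ⟨fun hx => ⟨hx.1, h.2.1.trans hx.2.1, hx.2.2.trans h.2.2⟩,
    fun hx => ⟨hx.1, h.2.2.trans hx.2.1, hx.2.2.trans h.2.1⟩⟩

theorem component_mem_sccs {AF : ArgFramework α} {a : α} (ha : a ∈ AF.args) :
    AF.component a ∈ AF.sccs := by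
  refine ⟨fun x hx => hx.1, ⟨a, mem_component_self ha⟩, fun x hx y hy => ?_, ?_⟩
  · exact ⟨reachable_iff.2 ⟨hx.1, hx.2.2.trans hy.2.1⟩, reachable_iff.2 ⟨hy.1, hy.2.2.trans hx.2.1⟩⟩
  · rintro x hx ⟨c, ⟨hc, hcn⟩, h₁, h₂⟩
    exact hcn ⟨hc, hx.2.1.trans (reachable_iff.1 h₁).2, (reachable_iff.1 h₂).2.trans hx.2.2⟩

theorem eq_component_of_mem_sccs {AF : ArgFramework α} {C : Set α} (hC : C ∈ AF.sccs) {a : α}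
    (ha : a ∈ C) : C = AF.component a := by
  ext x
  constructor
  · intro hx
    have := hC.2.2.1 a ha x hx
    exact ⟨hC.1 hx, (reachable_iff.1 this.1).2, (reachable_iff.1 this.2).2⟩
  · intro hx
    by_contra hxC
    exact hC.2.2.2 a ha ⟨x, ⟨hx.1, hxC⟩, reachable_iff.2 ⟨hC.1 ha, hx.2.1⟩,
      reachable_iff.2 ⟨hx.1, hx.2.2⟩⟩

theorem component_eq_singleton {AF : ArgFramework α} {a : α} (ha : a ∈ AF.args)
    (h : ¬ TransGen AF.attacks a a) : AF.component a = {a} := by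
  refine Set.eq_singleton_iff_unique_mem.2 ⟨mem_component_self ha, fun x hx => ?_⟩
  rcases reflTransGen_iff_eq_or_transGen.1 hx.2.1 with h' | h'
  · exact h'
  · exact absurd (h'.trans_left hx.2.2) h

theorem sccs_eq_singleton {AF : ArgFramework α} (h : AF.args ∈ AF.sccs) : AF.sccs = {AF.args} := by
  refine Set.eq_singleton_iff_unique_mem.2 ⟨h, fun C hC => ?_⟩
  obtain ⟨a, ha⟩ := hC.2.1
  rw [eq_component_of_mem_sccs hC ha, ← eq_component_of_mem_sccs h (hC.1 ha)]

/-- The provisionally defeated part is removed and then put back, so only the defeated arguments are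
missing from `C`. -/
theorem mem_sccUP {AF : ArgFramework α} {C E : Set α} {a : α} :
    a ∈ AF.sccUP C E ↔ a ∈ C ∧ ∀ b ∈ E, b ∉ C → ¬ AF.attacks b a := by
  have hD : a ∈ AF.sccD C E ↔ a ∈ C ∧ ∃ b ∈ E, b ∉ C ∧ AF.attacks b a := by
    constructor
    · rintro ⟨ha, b, ⟨hb, hb'⟩, hba⟩
      exact ⟨ha, b, hb, hb'.2.1, hba⟩
    · rintro ⟨ha, b, hb, hbC, hba⟩
      exact ⟨ha, b, ⟨hb, (AF.mem_of_attacks hba).1, hbC, a, ha, hba⟩, hba⟩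
  have hUP : a ∈ AF.sccUP C E ↔ a ∈ C ∧ a ∉ AF.sccD C E := by
    constructor
    · rintro (⟨ha, h⟩ | ⟨ha, h, _⟩)
      · exact ⟨ha, fun h' => h (Or.inl h')⟩
      · exact ⟨ha, fun h' => h h'.2⟩
    · rintro ⟨ha, h⟩
      by_cases hP : a ∈ AF.sccP C E
      · exact Or.inr hP
      · exact Or.inl ⟨ha, fun h' => h'.elim h hP⟩
  rw [hUP, hD]
  constructor
  · rintro ⟨ha, h⟩
    exact ⟨ha, fun b hb hbC hba => h ⟨ha, b, hb, hbC, hba⟩⟩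
  · rintro ⟨ha, h⟩
    exact ⟨ha, fun ⟨_, b, hb, hbC, hba⟩ => h b hb hbC hba⟩

theorem sccUP_subset {AF : ArgFramework α} {C E : Set α} : AF.sccUP C E ⊆ C :=
  fun _ h => (mem_sccUP.1 h).1

theorem restrict_self {AF : ArgFramework α} {S : Set α} (h : AF.args ⊆ S) : AF.restrict S = AF := by
  ext a b
  · exact ⟨fun h' => h'.1, fun h' => ⟨h', h h'⟩⟩
  · exact ⟨fun h' => h'.1, fun h' =>
      ⟨h', h (AF.mem_of_attacks h').1, h (AF.mem_of_attacks h').2⟩⟩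

/-! ### SCC-recursive semantics -/

/-- The component-wise condition also holds in the base case. -/
theorem SCCRecursive.forall_sccs {base : ArgSemantics α} {AF : ArgFramework α} {E : Set α}
    (h : SCCRecursive base AF E) {C : Set α} (hC : C ∈ AF.sccs) :
    SCCRecursive base (AF.restrict (AF.sccUP C E)) (E ∩ C) := by
  cases h with
  | many _ _ _ _ h => exact h C hC
  | single _ _ hE h1 h =>
    have hargs : AF.args ⊆ C := by
      intro x hx
      obtain ⟨D, hD⟩ := Set.ncard_eq_one.1 h1
      have h₁ : C = D := by rw [hD] at hC; exact hC
      have h₂ := component_mem_sccs hx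
      rw [hD] at h₂
      rw [h₁, ← Set.mem_singleton_iff.1 h₂]
      exact mem_component_self hx
    rw [Set.inter_eq_left.2 (hE.trans hargs), restrict_self]
    · exact .single AF E hE h1 h
    · exact fun x hx => mem_sccUP.2 ⟨hargs hx, fun b hb hbC => absurd (hargs (hE hb)) hbC⟩

theorem SCCRecursive.subset_args {base : ArgSemantics α} {AF : ArgFramework α} {E : Set α}
    (h : SCCRecursive base AF E) : E ⊆ AF.args := by
  cases h <;> assumption

/-- A sole component contains all arguments and has no outside attackers, so its restriction is `AF`
itself. With `SCCRecursive.forall_sccs` this removes the case split on the number of components. -/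
theorem sccRecursive_of_forall {base : ArgSemantics α} {AF : ArgFramework α} {E : Set α}
    (hE : E ⊆ AF.args)
    (h : ∀ C ∈ AF.sccs, SCCRecursive base (AF.restrict (AF.sccUP C E)) (E ∩ C)) :
    SCCRecursive base AF E := by
  by_cases h1 : AF.sccs.ncard = 1
  · obtain ⟨C, hC⟩ := Set.ncard_eq_one.1 h1
    have hCm : C ∈ AF.sccs := by rw [hC]; rfl
    have hargs : AF.args ⊆ C := by
      intro x hx
      have h₂ := component_mem_sccs hx
      rw [hC] at h₂
      rw [← Set.mem_singleton_iff.1 h₂]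
      exact mem_component_self hx
    have := h C hCm
    rwa [Set.inter_eq_left.2 (hE.trans hargs), restrict_self] at this
    exact fun x hx => mem_sccUP.2 ⟨hargs hx, fun b hb hbC => absurd (hargs (hE hb)) hbC⟩
  · exact .many AF E hE h1 h

theorem sccRecursive_empty {base : ArgSemantics α} {AF : ArgFramework α} (h : AF.args = ∅) :
    SCCRecursive base AF ∅ := by
  refine sccRecursive_of_forall (Set.empty_subset _) fun C hC => ?_
  obtain ⟨a, ha⟩ := hC.2.1
  have := hC.1 ha
  simp [h] at this

/-- A set defined by recursion along a rank function. -/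
theorem exists_set_mem_iff (rank : α → ℕ) (Φ : Set α → α → Prop)
    (hΦ : ∀ a S T, (∀ b, rank b < rank a → (b ∈ S ↔ b ∈ T)) → (Φ S a → Φ T a)) :
    ∃ E : Set α, ∀ a, a ∈ E ↔ Φ E a := by
  -- `Φ` is evaluated on the part of the set of rank below `a`; by `hΦ` this gives the same answer
  -- as the full set.
  let F : ∀ a, (∀ b, rank b < rank a → Prop) → Prop :=
    fun a rec => Φ {b | ∃ h : rank b < rank a, rec b h} a
  let wf : WellFounded fun b a => rank b < rank a := (measure rank).wf
  refine ⟨{a | wf.fix F a}, fun a => ?_⟩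
  have key : ∀ b, rank b < rank a →
      (b ∈ {b | ∃ _ : rank b < rank a, wf.fix F b} ↔ b ∈ {a | wf.fix F a}) :=
    fun b hb => ⟨fun h => h.2, fun h => ⟨hb, h⟩⟩
  rw [Set.mem_ofPred_eq, wf.fix_eq]
  exact ⟨hΦ a _ _ key, hΦ a _ _ fun b hb => (key b hb).symm⟩

/-- The number of arguments that reach a given one serves as rank: it is strictly smaller on
components strictly upstream, since `a` reaches itself but not `b`. -/
theorem rank_lt {AF : ArgFramework α} {a b : α} (hab : ReflTransGen AF.attacks b a)
    (ha : a ∈ AF.args) (h : ¬ ReflTransGen AF.attacks a b) :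
    {x | x ∈ AF.args ∧ ReflTransGen AF.attacks x b}.ncard <
      {x | x ∈ AF.args ∧ ReflTransGen AF.attacks x a}.ncard := by
  refine Set.ncard_lt_ncard ⟨fun x hx => ⟨hx.1, hx.2.trans hab⟩, fun hsub => ?_⟩
    (AF.finite_args.subset fun x hx => hx.1)
  exact h (hsub ⟨ha, .refl⟩).2

/-- Two recursions are nested: induction on the number of arguments supplies extensions of proper
restrictions, and recursion along the order of components glues them together. -/
theorem exists_sccRecursive {base : ArgSemantics α} (hb : ∀ AF, ∃ E ∈ base AF, E ⊆ AF.args)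
    (AF : ArgFramework α) : ∃ E, SCCRecursive base AF E := by
  induction hn : AF.args.ncard using Nat.strong_induction_on generalizing AF with
  | _ n ih =>
  by_cases h1 : AF.sccs.ncard = 1
  · obtain ⟨E, hE, hsub⟩ := hb AF
    exact ⟨E, .single AF E hsub h1 hE⟩
  -- The choice depends on `X` alone and precedes `E`, so all members of a component consult the
  -- same extension. The value `∅` for improper restrictions is never used.
  have hex : ∀ X : Set α, ∃ E, AF.args ∩ X ≠ AF.args → SCCRecursive base (AF.restrict X) E := by
    intro X
    by_cases hX : AF.args ∩ X = AF.args
    · exact ⟨∅, fun h => absurd hX h⟩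
    · obtain ⟨E, hE⟩ := ih _ (hn ▸ Set.ncard_lt_ncard
        (Set.inter_subset_left.ssubset_of_ne hX) AF.finite_args) (AF.restrict X) rfl
      exact ⟨E, fun _ => hE⟩
  choose f hf using hex
  obtain ⟨E, hE⟩ := exists_set_mem_iff
    (fun a => {x | x ∈ AF.args ∧ ReflTransGen AF.attacks x a}.ncard)
    (fun S a => a ∈ AF.args ∧ a ∈ f (AF.sccUP (AF.component a) S)) (by
      rintro a S T hST ⟨ha, h⟩
      refine ⟨ha, ?_⟩
      convert h using 2
      ext x
      rw [mem_sccUP, mem_sccUP]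
      refine and_congr_right fun hx => forall_congr' fun b => ?_
      by_cases hb : b ∉ AF.component a ∧ AF.attacks b x
      · have hba : ReflTransGen AF.attacks b a := hx.2.2.head hb.2
        rw [hST b (rank_lt hba ha fun hab => hb.1 ⟨(AF.mem_of_attacks hb.2).1, hab, hba⟩)]
      · grind)
  refine ⟨E, .many AF E (fun a ha => ((hE a).1 ha).1) h1 fun C hC => ?_⟩
  have hne : AF.args ∩ AF.sccUP C E ≠ AF.args := by
    intro h
    have hCa : C = AF.args := hC.1.antisymm ((Set.inter_eq_left.1 h).trans sccUP_subset)
    exact h1 (by rw [sccs_eq_singleton (hCa ▸ hC), Set.ncard_singleton])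
  have hfC := hf _ hne
  have : E ∩ C = f (AF.sccUP C E) := by
    ext x
    constructor
    · rintro ⟨hx, hxC⟩
      rw [eq_component_of_mem_sccs hC hxC]
      exact ((hE x).1 hx).2
    · intro hx
      have hxC : x ∈ C := sccUP_subset (hfC.subset_args hx).2
      refine ⟨(hE x).2 ⟨hC.1 hxC, ?_⟩, hxC⟩
      rwa [← eq_component_of_mem_sccs hC hxC]
  rwa [this]

/-- On an argument that lies on no cycle, an SCC-recursive extension is determined by the
attackers of that argument. -/
theorem SCCRecursive.mem_iff {base : ArgSemantics α}
    (hb : ∀ (AF : ArgFramework α) (x : α), AF.args = {x} → (∀ a b, ¬ AF.attacks a b) →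
      ∀ E ∈ base AF, x ∈ E)
    {AF : ArgFramework α} {E : Set α} (h : SCCRecursive base AF E) {x : α} (hx : x ∈ AF.args)
    (hcyc : ¬ TransGen AF.attacks x x) : x ∈ E ↔ ∀ y ∈ E, ¬ AF.attacks y x := by
  have hC : {x} ∈ AF.sccs := component_eq_singleton hx hcyc ▸ component_mem_sccs hx
  have hrec := h.forall_sccs hC
  constructor
  · intro hxE y hy hyx
    have := mem_sccUP.1 (hrec.subset_args ⟨hxE, rfl⟩).2
    refine this.2 y hy ?_ hyx
    rintro rfl
    exact hcyc (.single hyx)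
  · intro hno
    have hargs : (AF.restrict (AF.sccUP {x} E)).args = {x} := by
      refine Set.eq_singleton_iff_unique_mem.2 ⟨⟨hx, mem_sccUP.2 ⟨rfl, fun b hb _ => hno b hb⟩⟩, ?_⟩
      exact fun y hy => Set.mem_singleton_iff.1 (sccUP_subset hy.2)
    have hatt : ∀ a b, ¬ (AF.restrict (AF.sccUP {x} E)).attacks a b := by
      rintro a b ⟨hab, ha, hb⟩
      obtain rfl : a = x := Set.mem_singleton_iff.1 (sccUP_subset ha)
      obtain rfl : b = a := Set.mem_singleton_iff.1 (sccUP_subset hb)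
      exact hcyc (.single hab)
    have hmem : (AF.restrict (AF.sccUP {x} E)).args ∈ (AF.restrict (AF.sccUP {x} E)).sccs := by
      have hx' : x ∈ (AF.restrict (AF.sccUP {x} E)).args := by rw [hargs]; rfl
      have := component_mem_sccs hx'
      rw [component_eq_singleton hx'] at this
      · rwa [hargs]
      · intro h'
        obtain ⟨c, hc, _⟩ := TransGen.head'_iff.1 h'
        exact hatt _ _ hc
    have h1 : (AF.restrict (AF.sccUP {x} E)).sccs.ncard = 1 := by
      rw [sccs_eq_singleton hmem, Set.ncard_singleton]
    rcases ((sccRecursive_iff _ _ _).1 hrec).2 with h' | h'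
    · exact (hb _ x hargs hatt _ h'.2).1
    · exact absurd h1 h'.1

/-! ### Existence of extensions -/

theorem finite_setOf_subset_args {AF : ArgFramework α} {P : Set α → Prop}
    (hP : ∀ S, P S → S ⊆ AF.args) : {S | P S}.Finite :=
  AF.finite_args.finite_subsets.subset hP

theorem conflictFree_empty {AF : ArgFramework α} : AF.ConflictFree ∅ :=
  ⟨Set.empty_subset _, by simp⟩

theorem admissible_empty {AF : ArgFramework α} : AF.Admissible ∅ :=
  ⟨conflictFree_empty, by simp⟩

theorem exists_naive (AF : ArgFramework α) : ∃ E ∈ naive AF, E ⊆ AF.args := by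
  obtain ⟨E, hE⟩ := (finite_setOf_subset_args (AF := AF) (P := AF.ConflictFree)
    fun S hS => hS.1).exists_maximal ⟨∅, conflictFree_empty⟩
  exact ⟨E, hE, hE.prop.1⟩

/-- Maximality among the sets whose value lies above `f S` already is maximality among all. -/
theorem exists_maximalFor_ge {AF : ArgFramework α} {P : Set α → Prop}
    (hP : ∀ S, P S → S ⊆ AF.args) (f : Set α → Set α) {S : Set α} (hS : P S) :
    ∃ E, MaximalFor P f E ∧ f S ⊆ f E := by
  have hfin : {T | P T ∧ f S ⊆ f T}.Finite := finite_setOf_subset_args fun T hT => hP T hT.1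
  obtain ⟨E, hE⟩ := hfin.exists_maximalFor f _ ⟨S, hS, subset_rfl⟩
  exact ⟨E, ⟨hE.prop.1, fun T hT h => hE.le_of_le ⟨hT, hE.prop.2.trans h⟩ h⟩, hE.prop.2⟩

theorem exists_maximal_ge {AF : ArgFramework α} {P : Set α → Prop}
    (hP : ∀ S, P S → S ⊆ AF.args) {S : Set α} (hS : P S) : ∃ E, Maximal P E ∧ S ⊆ E := by
  obtain ⟨E, hE, h⟩ := exists_maximalFor_ge hP id hS
  exact ⟨E, ⟨hE.prop, fun T hT h' => hE.le_of_le hT h'⟩, h⟩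

theorem exists_stage (AF : ArgFramework α) : ∃ E ∈ stage AF, E ⊆ AF.args := by
  obtain ⟨E, hE, _⟩ := exists_maximalFor_ge (AF := AF) (P := AF.ConflictFree) (fun S hS => hS.1)
    AF.range conflictFree_empty
  exact ⟨E, hE, hE.prop.1⟩

theorem conflictFree_of_no_attacks {AF : ArgFramework α} (h : ∀ a b, ¬ AF.attacks a b) :
    AF.ConflictFree AF.args := ⟨subset_rfl, fun a _ b _ => h a b⟩

theorem mem_naive_singleton (AF : ArgFramework α) (x : α) (hx : AF.args = {x})
    (h : ∀ a b, ¬ AF.attacks a b) : ∀ E ∈ naive AF, x ∈ E := fun E hE =>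
  Maximal.le_of_ge hE (conflictFree_of_no_attacks h) (Maximal.prop hE).1 (by rw [hx]; rfl)

theorem mem_stage_singleton (AF : ArgFramework α) (x : α) (hx : AF.args = {x})
    (h : ∀ a b, ¬ AF.attacks a b) : ∀ E ∈ stage AF, x ∈ E := by
  intro E hE
  have hx' : x ∈ AF.range E := by
    refine MaximalFor.le_of_le hE (conflictFree_of_no_attacks h) ?_ (Or.inl (by rw [hx]; rfl))
    rintro y (hy | ⟨_, a, _, hay⟩)
    · exact Or.inl ((MaximalFor.prop hE).1 hy)
    · exact absurd hay (h _ _)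
  rcases hx' with hx' | ⟨_, a, _, hax⟩
  · exact hx'
  · exact absurd hax (h _ _)

theorem Acceptable.mono {AF : ArgFramework α} {S T : Set α} {a : α} (h : AF.Acceptable S a)
    (hST : S ⊆ T) : AF.Acceptable T a :=
  ⟨h.1, fun b hb hba => let ⟨c, hc, hcb⟩ := h.2 b hb hba; ⟨c, hST hc, hcb⟩⟩

/-- A maximal admissible set with the property `Q` is complete if adding an acceptable argument
preserves conflict-freeness and `Q`. -/
theorem complete_of_maximal {AF : ArgFramework α} {Q : Set α → Prop} {S : Set α}
    (hS : Maximal (fun T => AF.Admissible T ∧ Q T) S)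
    (h : ∀ a, AF.Acceptable S a → AF.ConflictFree (insert a S) ∧ Q (insert a S)) :
    S ∈ complete AF := by
  refine ⟨hS.prop.1, fun a _ hacc => ?_⟩
  obtain ⟨hcf, hQ⟩ := h a hacc
  refine hS.le_of_ge ⟨⟨hcf, ?_⟩, hQ⟩ (Set.subset_insert _ _) (Set.mem_insert _ _)
  rintro b (rfl | hb)
  · exact hacc.mono (Set.subset_insert _ _)
  · exact (hS.prop.1.2 b hb).mono (Set.subset_insert _ _)

/-- Any conflict involving `a` is answered by a counterattack from `S`, which leads back to a
conflict inside `S`. -/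
theorem conflictFree_insert {AF : ArgFramework α} {S : Set α} {a : α} (hS : AF.Admissible S)
    (ha : AF.Acceptable S a) : AF.ConflictFree (insert a S) := by
  have h₁ : ∀ b ∈ S, ¬ AF.attacks b a := fun b hb hba => by
    obtain ⟨c, hc, hcb⟩ := ha.2 b (AF.mem_of_attacks hba).1 hba
    exact hS.1.2 c hc b hb hcb
  have h₂ : ∀ b ∈ S, ¬ AF.attacks a b := fun b hb hab => by
    obtain ⟨c, hc, hca⟩ := (hS.2 b hb).2 a ha.1 hab
    exact h₁ c hc hca
  have h₃ : ¬ AF.attacks a a := fun haa => by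
    obtain ⟨c, hc, hca⟩ := ha.2 a ha.1 haa
    exact h₁ c hc hca
  refine ⟨Set.insert_subset ha.1 hS.1.1, ?_⟩
  rintro b (rfl | hb) c (rfl | hc)
  · exact h₃
  · exact h₂ c hc
  · exact h₁ b hb
  · exact hS.1.2 b hb c hc

theorem preferred_subset_complete (AF : ArgFramework α) : preferred AF ⊆ complete AF := by
  intro S hS
  have hS' : Maximal AF.Admissible S := hS
  refine complete_of_maximal (Q := fun _ => True) (by simpa using hS') fun a ha =>
    ⟨conflictFree_insert hS'.prop ha, trivial⟩

theorem preferred_nonempty (AF : ArgFramework α) : (preferred AF).Nonempty :=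
  let ⟨E, hE, _⟩ := exists_maximal_ge (AF := AF) (fun _ hS => hS.1.1) admissible_empty
  ⟨E, hE⟩

theorem preferred_eq (AF : ArgFramework α) :
    preferred AF = {S | Maximal (fun T => T ∈ complete AF) S} := by
  ext S
  constructor
  · exact fun hS => ⟨preferred_subset_complete AF hS, fun T hT h => Maximal.le_of_ge hS hT.1 h⟩
  · intro hS
    obtain ⟨E, hE, hSE⟩ := exists_maximal_ge (AF := AF) (fun _ hS => hS.1.1)
      (Maximal.prop hS).1
    have : E ⊆ S := Maximal.le_of_ge hS (preferred_subset_complete AF hE) hSE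
    rwa [hSE.antisymm this]

theorem complete_nonempty (AF : ArgFramework α) : (complete AF).Nonempty :=
  (preferred_nonempty AF).mono (preferred_subset_complete AF)

theorem grounded_nonempty (AF : ArgFramework α) : (grounded AF).Nonempty :=
  (finite_setOf_subset_args (AF := AF) (P := fun S => S ∈ complete AF)
    fun _ hS => hS.1.1.1).exists_minimal (complete_nonempty AF)

theorem grounded_subset_complete (AF : ArgFramework α) : grounded AF ⊆ complete AF :=
  fun _ hS => Minimal.prop hS

theorem semiStable_nonempty (AF : ArgFramework α) : (semiStable AF).Nonempty := by
  obtain ⟨S, hS⟩ := complete_nonempty AF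
  obtain ⟨E, hE, _⟩ := exists_maximalFor_ge (AF := AF) (P := fun S => S ∈ complete AF)
    (fun _ hS => hS.1.1.1) AF.range hS
  exact ⟨E, hE⟩

theorem semiStable_subset_complete (AF : ArgFramework α) : semiStable AF ⊆ complete AF :=
  fun _ hS => MaximalFor.prop hS

/-- Maximal among the admissible sets contained in every member of the family `F`; ideal and eager
extensions are of this form. -/
def idealFor (AF : ArgFramework α) (F : Set (Set α)) : Set (Set α) :=
  {S | Maximal (fun T => AF.Admissible T ∧ ∀ P ∈ F, T ⊆ P) S}

theorem idealFor_nonempty (AF : ArgFramework α) (F : Set (Set α)) : (AF.idealFor F).Nonempty :=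
  let ⟨E, hE, _⟩ := exists_maximal_ge (AF := AF) (P := fun T => AF.Admissible T ∧ ∀ P ∈ F, T ⊆ P)
    (fun _ hS => hS.1.1.1) ⟨admissible_empty, fun _ _ => Set.empty_subset _⟩
  ⟨E, hE⟩

/-- What is acceptable with respect to `S` is acceptable with respect to every larger `P ∈ F`, hence
lies in `P` by completeness. -/
theorem idealFor_subset_complete {AF : ArgFramework α} {F : Set (Set α)} (hF : F ⊆ complete AF) :
    AF.idealFor F ⊆ complete AF := fun S hS => by
  have hS' : Maximal (fun T => AF.Admissible T ∧ ∀ P ∈ F, T ⊆ P) S := hS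
  refine complete_of_maximal hS' fun a ha => ⟨conflictFree_insert hS'.prop.1 ha, fun P hP => ?_⟩
  exact Set.insert_subset ((hF hP).2 a ha.1 (ha.mono (hS'.prop.2 P hP))) (hS'.prop.2 P hP)

/-! ### Rational man's expansions -/

namespace RationalManExpansion

variable {AF AF' : ArgFramework α}

theorem args_subset (h : RationalManExpansion AF AF') : AF.args ⊆ AF'.args := h.1.1

theorem attacks_iff (h : RationalManExpansion AF AF') {a b : α} (ha : a ∈ AF.args)
    (hb : b ∈ AF.args) : AF'.attacks a b ↔ AF.attacks a b :=
  ⟨fun hab => by_contra fun hn => h.2.1.2 ⟨a, b, ⟨hab, hn⟩, ha, hb⟩, h.1.2 a b⟩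

/-- The arguments of `AF'` from which some argument outside `AF` can be reached. -/
def ancestors (AF AF' : ArgFramework α) : Set α :=
  {x | x ∈ AF'.args ∧ ∃ b ∈ AF'.args \ AF.args, ReflTransGen AF'.attacks x b}

theorem mem_ancestors_of_attacks {x y : α} (hx : x ∈ ancestors AF AF') (hyx : AF'.attacks y x) :
    y ∈ ancestors AF AF' :=
  let ⟨_, b, hb, hxb⟩ := hx
  ⟨(AF'.mem_of_attacks hyx).1, b, hb, hxb.head hyx⟩

theorem mem_ancestors_of_new {x : α} (hx : x ∈ AF'.args) (hx' : x ∉ AF.args) :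
    x ∈ ancestors AF AF' := ⟨hx, x, ⟨hx, hx'⟩, .refl⟩

theorem not_transGen (h : RationalManExpansion AF AF') {x : α} (hx : x ∈ ancestors AF AF') :
    ¬ TransGen AF'.attacks x x := by
  intro hxx
  obtain ⟨C, hC, hxC⟩ := exists_cycle_of_transGen hxx
  obtain ⟨hx', b, hb, hxb⟩ := hx
  by_cases hxA : x ∈ AF.args
  · exact h.2.2.2 x hxA b hb (reachable_iff.2 ⟨hx', hxb⟩) C hC hxC
  · rw [h.2.2.1.2] at hC
    exact hxA (hC.1 x hxC)

/-- On the finite set of ancestors the transitive closure of attack is irreflexive, hence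
well-founded; closure under attackers makes the induction hypothesis cover every attacker. -/
theorem ancestors_induction (h : RationalManExpansion AF AF') {P : α → Prop}
    (step : ∀ x ∈ ancestors AF AF', (∀ y, AF'.attacks y x → P y) → P x) :
    ∀ x ∈ ancestors AF AF', P x := by
  have hfin : Finite (ancestors AF AF') := (AF'.finite_args.subset fun _ hx => hx.1).to_subtype
  let r : ancestors AF AF' → ancestors AF AF' → Prop := fun x y => TransGen AF'.attacks x y
  have : IsTrans _ r := ⟨fun _ _ _ => TransGen.trans⟩
  have : Std.Irrefl r := ⟨fun x => h.not_transGen x.2⟩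
  have wf : WellFounded r := Finite.wellFounded_of_trans_of_irrefl r
  intro x hx
  induction hx' : (⟨x, hx⟩ : ancestors AF AF') using wf.induction generalizing x with
  | _ z ih =>
    subst hx'
    exact step x hx fun y hyx => ih ⟨y, mem_ancestors_of_attacks hx hyx⟩ (.single hyx) y _ rfl

/-- Two sets that are locally conflict-free and cover each other coincide on the ancestors of the
new arguments. -/
theorem mem_iff_mem (h : RationalManExpansion AF AF') {S T : Set α}
    (hS : ∀ x ∈ S, x ∈ ancestors AF AF' → ∀ y ∈ S, ¬ AF'.attacks y x)
    (hT : ∀ x ∈ T, x ∈ ancestors AF AF' → ∀ y ∈ T, ¬ AF'.attacks y x)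
    (hST : ∀ x ∈ S, x ∈ ancestors AF AF' → x ∉ T → ∃ y ∈ T, AF'.attacks y x)
    (hTS : ∀ x ∈ T, x ∈ ancestors AF AF' → x ∉ S → ∃ y ∈ S, AF'.attacks y x) :
    ∀ x ∈ ancestors AF AF', (x ∈ S ↔ x ∈ T) := by
  refine h.ancestors_induction fun x hx ih => ⟨fun hxS => ?_, fun hxT => ?_⟩
  · by_contra hxT
    obtain ⟨y, hy, hyx⟩ := hST x hxS hx hxT
    exact hS x hxS hx y ((ih y hyx).2 hy) hyx
  · by_contra hxS
    obtain ⟨y, hy, hyx⟩ := hTS x hxT hx hxS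
    exact hT x hxT hx y ((ih y hyx).1 hy) hyx

/-- Complete extensions behave like stable ones on the ancestors: if `E` contains no attacker of
`x`, then by induction it attacks all of them, so `x` is acceptable and belongs to `E`. -/
theorem attacks_of_not_mem_complete (h : RationalManExpansion AF AF') {E : Set α}
    (hE : E ∈ complete AF') :
    ∀ x ∈ ancestors AF AF', x ∉ E → ∃ y ∈ E, AF'.attacks y x := by
  refine h.ancestors_induction fun x hx ih hxE => ?_
  by_contra hno
  refine hxE (hE.2 x hx.1 ⟨hx.1, fun b _ hbx => ih b hbx fun hb => hno ⟨b, hb, hbx⟩⟩)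

theorem attacks_of_not_mem_complete_left (h : RationalManExpansion AF AF') {E : Set α}
    (hE : E ∈ complete AF) :
    ∀ x ∈ ancestors AF AF', x ∈ AF.args → x ∉ E → ∃ y ∈ E, AF'.attacks y x := by
  refine h.ancestors_induction fun x hx ih hxA hxE => ?_
  by_contra hno
  refine hxE (hE.2 x hxA ⟨hxA, fun b hb hbx => ?_⟩)
  obtain ⟨y, hy, hyb⟩ := ih b (h.1.2 _ _ hbx) hb fun hbE => hno ⟨b, hbE, h.1.2 _ _ hbx⟩
  exact ⟨y, hy, (h.attacks_iff (hE.1.1.1 hy) hb).1 hyb⟩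

theorem conflictFree_right (h : RationalManExpansion AF AF') {E : Set α}
    (hE : AF.ConflictFree E) : AF'.ConflictFree E :=
  ⟨hE.1.trans h.args_subset, fun a ha b hb hab =>
    hE.2 a ha b hb ((h.attacks_iff (hE.1 ha) (hE.1 hb)).1 hab)⟩

theorem conflictFree_left (h : RationalManExpansion AF AF') {E : Set α}
    (hE : AF'.ConflictFree E) (hsub : E ⊆ AF.args) : AF.ConflictFree E :=
  ⟨hsub, fun a ha b hb hab => hE.2 a ha b hb (h.1.2 a b hab)⟩

theorem admissible_left (h : RationalManExpansion AF AF') {E : Set α}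
    (hE : AF'.Admissible E) (hsub : E ⊆ AF.args) : AF.Admissible E := by
  refine ⟨h.conflictFree_left hE.1 hsub, fun a ha => ⟨hsub ha, fun b hb hba => ?_⟩⟩
  obtain ⟨c, hc, hcb⟩ := (hE.2 a ha).2 b (h.args_subset hb) (h.1.2 _ _ hba)
  exact ⟨c, hc, (h.attacks_iff (hsub hc) hb).1 hcb⟩

theorem acceptable_right (h : RationalManExpansion AF AF') {E : Set α} {a : α}
    (hnew : ∀ n ∈ AF'.args, n ∉ AF.args → ∃ y ∈ E, AF'.attacks y n)
    (ha : AF.Acceptable E a) : AF'.Acceptable E a := by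
  refine ⟨h.args_subset ha.1, fun b hb hba => ?_⟩
  by_cases hbA : b ∈ AF.args
  · obtain ⟨c, hc, hcb⟩ := ha.2 b hbA ((h.attacks_iff hbA ha.1).1 hba)
    exact ⟨c, hc, h.1.2 _ _ hcb⟩
  · exact hnew b hb hbA

theorem acceptable_left (h : RationalManExpansion AF AF') {E : Set α} {a : α}
    (hsub : E ⊆ AF.args) (haA : a ∈ AF.args)
    (ha : AF'.Acceptable E a) : AF.Acceptable E a := by
  refine ⟨haA, fun b hb hba => ?_⟩
  obtain ⟨c, hc, hcb⟩ := ha.2 b (h.args_subset hb) (h.1.2 _ _ hba)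
  exact ⟨c, hc, (h.attacks_iff (hsub hc) hb).1 hcb⟩

/-! ### Transfer when some complete extension of `AF'` has only old arguments -/

section OldComplete

variable {E₀ : Set α}

/-- If one complete extension of `AF'` has no new arguments, then none has. -/
theorem subset_args_of_complete (h : RationalManExpansion AF AF') (hE₀ : E₀ ∈ complete AF')
    (hsub : E₀ ⊆ AF.args) {E : Set α} (hE : E ∈ complete AF') : E ⊆ AF.args := by
  intro x hx
  by_contra hxA
  have hanc := mem_ancestors_of_new (hE.1.1.1 hx) hxA
  have := h.mem_iff_mem (fun x hx _ y hy => hE.1.1.2 y hy x hx)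
    (fun x hx _ y hy => hE₀.1.1.2 y hy x hx)
    (fun x _ hx' => h.attacks_of_not_mem_complete hE₀ x hx')
    (fun x _ hx' => h.attacks_of_not_mem_complete hE x hx') x hanc
  exact hxA (hsub (this.1 hx))

/-- `E₀` attacks `n` from an ancestor, and `E` agrees with `E₀` on ancestors. -/
theorem attacks_new_of_complete (h : RationalManExpansion AF AF') (hE₀ : E₀ ∈ complete AF')
    (hsub : E₀ ⊆ AF.args) {E : Set α} (hE : E ∈ complete AF) :
    ∀ n ∈ AF'.args, n ∉ AF.args → ∃ y ∈ E, AF'.attacks y n := by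
  intro n hn hnA
  have hanc := mem_ancestors_of_new hn hnA
  obtain ⟨y, hy, hyn⟩ := h.attacks_of_not_mem_complete hE₀ n hanc fun hn' => hnA (hsub hn')
  have := h.mem_iff_mem (fun x hx _ y hy => (h.conflictFree_right hE.1.1).2 y hy x hx)
    (fun x hx _ y hy => hE₀.1.1.2 y hy x hx)
    (fun x _ hx' => h.attacks_of_not_mem_complete hE₀ x hx')
    (fun x hx hx' => h.attacks_of_not_mem_complete_left hE x hx' (hsub hx))
    y (mem_ancestors_of_attacks hanc hyn)
  exact ⟨y, this.2 hy, hyn⟩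

theorem complete_eq (h : RationalManExpansion AF AF') (hE₀ : E₀ ∈ complete AF')
    (hsub : E₀ ⊆ AF.args) : complete AF = complete AF' := by
  ext E
  constructor
  · intro hE
    have hnew := h.attacks_new_of_complete hE₀ hsub hE
    refine ⟨⟨h.conflictFree_right hE.1.1, fun a ha => h.acceptable_right hnew (hE.1.2 a ha)⟩,
      fun a ha hacc => ?_⟩
    by_cases haA : a ∈ AF.args
    · exact hE.2 a haA (h.acceptable_left hE.1.1.1 haA hacc)
    -- To defend a new argument, `E` would have to attack the member of `E` that attacks it.
    · exfalso
      obtain ⟨y, hy, hya⟩ := hnew a ha haA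
      obtain ⟨z, hz, hzy⟩ := hacc.2 y (AF'.mem_of_attacks hya).1 hya
      exact (h.conflictFree_right hE.1.1).2 z hz y hy hzy
  · intro hE
    have hEA := h.subset_args_of_complete hE₀ hsub hE
    refine ⟨h.admissible_left hE.1 hEA, fun a ha hacc =>
      hE.2 a (h.args_subset ha) (h.acceptable_right (fun n hn hnA => ?_) hacc)⟩
    exact h.attacks_of_not_mem_complete hE n (mem_ancestors_of_new hn hnA) fun h' => hnA (hEA h')

theorem preferred_eq (h : RationalManExpansion AF AF') (hE₀ : E₀ ∈ complete AF')
    (hsub : E₀ ⊆ AF.args) : preferred AF = preferred AF' := by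
  rw [ArgFramework.preferred_eq, ArgFramework.preferred_eq, h.complete_eq hE₀ hsub]

theorem grounded_eq (h : RationalManExpansion AF AF') (hE₀ : E₀ ∈ complete AF')
    (hsub : E₀ ⊆ AF.args) : grounded AF = grounded AF' := by
  unfold grounded
  rw [h.complete_eq hE₀ hsub]

theorem range_inter (h : RationalManExpansion AF AF') {E : Set α} (hE : E ⊆ AF.args) :
    AF'.range E ∩ AF.args = AF.range E := by
  ext x
  constructor
  · rintro ⟨hx | ⟨_, a, ha, hax⟩, hxA⟩
    · exact Or.inl hx
    · exact Or.inr ⟨hxA, a, ha, (h.attacks_iff (hE ha) hxA).1 hax⟩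
  · rintro (hx | ⟨hxA, a, ha, hax⟩)
    · exact ⟨Or.inl hx, hE hx⟩
    · exact ⟨Or.inr ⟨h.args_subset hxA, a, ha, h.1.2 _ _ hax⟩, hxA⟩

theorem range_subset {AF : ArgFramework α} {E : Set α} (hE : E ⊆ AF.args) :
    AF.range E ⊆ AF.args := by
  rintro x (hx | hx)
  · exact hE hx
  · exact hx.1

/-- Both ranges in `AF'` contain all new arguments, so they can differ only on old ones. -/
theorem range_le_range_iff (h : RationalManExpansion AF AF') (hE₀ : E₀ ∈ complete AF')
    (hsub : E₀ ⊆ AF.args) {S T : Set α} (hS : S ∈ complete AF) (hT : T ∈ complete AF) :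
    AF'.range S ⊆ AF'.range T ↔ AF.range S ⊆ AF.range T := by
  rw [← h.range_inter hS.1.1.1, ← h.range_inter hT.1.1.1]
  constructor
  · exact fun hST => Set.inter_subset_inter_left _ hST
  · intro hST x hx
    by_cases hxA : x ∈ AF.args
    · exact (hST ⟨hx, hxA⟩).1
    · have hx' := range_subset (hS.1.1.1.trans h.args_subset) hx
      exact Or.inr ⟨hx', h.attacks_new_of_complete hE₀ hsub hT x hx' hxA⟩

theorem semiStable_eq (h : RationalManExpansion AF AF') (hE₀ : E₀ ∈ complete AF')
    (hsub : E₀ ⊆ AF.args) : semiStable AF = semiStable AF' := by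
  ext E
  simp only [semiStable, MaximalFor, Set.mem_ofPred_eq, ← h.complete_eq hE₀ hsub]
  refine and_congr_right fun hE => forall_congr' fun T => forall_congr' fun hT => ?_
  exact imp_congr (h.range_le_range_iff hE₀ hsub hE hT).symm
    (h.range_le_range_iff hE₀ hsub hT hE).symm

theorem idealFor_subset (h : RationalManExpansion AF AF') (hE₀ : E₀ ∈ complete AF')
    (hsub : E₀ ⊆ AF.args) {F : Set (Set α)} (hne : F.Nonempty) (hF : F ⊆ complete AF) :
    AF.idealFor F ⊆ AF'.idealFor F := by
  intro E hE
  have hEc := h.complete_eq hE₀ hsub ▸ idealFor_subset_complete hF hE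
  have hE' : Maximal (fun T => AF.Admissible T ∧ ∀ P ∈ F, T ⊆ P) E := hE
  refine ⟨⟨hEc.1, hE'.prop.2⟩, fun T hT hET => ?_⟩
  obtain ⟨P, hP⟩ := hne
  exact hE'.le_of_ge
    ⟨h.admissible_left hT.1 ((hT.2 P hP).trans (hF hP).1.1.1), hT.2⟩ hET

end OldComplete

/-- The conclusion for a semantics that selects among complete extensions. -/
theorem exists_extension_of_subset_complete {σ : ArgSemantics α}
    (hσ : σ AF' ⊆ complete AF') (hne : (σ AF').Nonempty)
    (hold : ∀ E₀ ∈ complete AF', E₀ ⊆ AF.args → σ AF ⊆ σ AF') {E : Set α} (hE : E ∈ σ AF) :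
    ∃ E' ∈ σ AF', ¬ E' ⊆ AF.args ∨ E' = E := by
  obtain ⟨E', hE'⟩ := hne
  by_cases hsub : E' ⊆ AF.args
  · exact ⟨E, hold E' (hσ hE') hsub hE, Or.inr rfl⟩
  · exact ⟨E', hE', Or.inl hsub⟩

/-- Take `E'` with range above that of `E`. If `E'` is old, maximality of `E` makes their ranges in
`AF` equal. Each set then attacks the members it lacks of the other, so they agree on ancestors and
attack the same new arguments. -/
theorem exists_stage_extension (h : RationalManExpansion AF AF') {E : Set α}
    (hE : E ∈ stage AF) : ∃ E' ∈ stage AF', ¬ E' ⊆ AF.args ∨ E' = E := by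
  have hcf := MaximalFor.prop hE
  obtain ⟨E', hE', hle⟩ := exists_maximalFor_ge (AF := AF') (P := AF'.ConflictFree)
    (fun _ hS => hS.1) AF'.range (h.conflictFree_right hcf)
  by_cases hsub : E' ⊆ AF.args
  · refine ⟨E, ?_, Or.inr rfl⟩
    have hcf' := h.conflictFree_left hE'.prop hsub
    have h₁ : AF.range E ⊆ AF.range E' := by
      rw [← h.range_inter hcf.1, ← h.range_inter hsub]
      exact Set.inter_subset_inter_left _ hle
    have h₂ : AF.range E' ⊆ AF.range E := MaximalFor.le_of_le hE hcf' h₁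
    have cover : ∀ {S T : Set α}, AF.range S ⊆ AF.range T →
        ∀ x ∈ S, x ∈ ancestors AF AF' → x ∉ T → ∃ y ∈ T, AF'.attacks y x := by
      intro S T hST x hx _ hxT
      rcases hST (Or.inl hx) with hx' | ⟨_, y, hy, hyx⟩
      · exact absurd hx' hxT
      · exact ⟨y, hy, h.1.2 _ _ hyx⟩
    have hiff := h.mem_iff_mem (fun x hx _ y hy => (h.conflictFree_right hcf).2 y hy x hx)
      (fun x hx _ y hy => hE'.prop.2 y hy x hx) (cover h₁) (cover h₂)
    have hge : AF'.range E' ⊆ AF'.range E := by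
      intro x hx
      by_cases hxA : x ∈ AF.args
      · have : x ∈ AF.range E' := by rw [← h.range_inter hsub]; exact ⟨hx, hxA⟩
        rw [← h.range_inter hcf.1] at h₂
        exact (h₂ this).1
      · rcases hx with hx | ⟨hx, y, hy, hyx⟩
        · exact absurd (hsub hx) hxA
        · have hy' := mem_ancestors_of_attacks (mem_ancestors_of_new hx hxA) hyx
          exact Or.inr ⟨hx, y, (hiff y hy').2 hy, hyx⟩
    exact ⟨h.conflictFree_right hcf, fun T hT hET =>
      (hE'.le_of_le hT (hge.trans hET)).trans hge⟩
  · exact ⟨E', hE', Or.inl hsub⟩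

/-! ### Components under expansion; CF2 and stage2 -/

theorem not_transGen_left (h : RationalManExpansion AF AF') {x : α} (hx : x ∈ ancestors AF AF') :
    ¬ TransGen AF.attacks x x := fun hxx => h.not_transGen hx (TransGen.mono h.1.2 _ _ hxx)

theorem reflTransGen_left (h : RationalManExpansion AF AF') {x y : α} (hx : x ∈ AF.args)
    (hxn : x ∉ ancestors AF AF') (hxy : ReflTransGen AF'.attacks x y) :
    ReflTransGen AF.attacks x y := by
  induction hxy with
  | refl => exact .refl
  | @tail b c hxb hbc ih =>
    have hb := mem_args_of_reflTransGen hx ih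
    have hc : c ∈ AF.args := by
      by_contra hc
      exact hxn ⟨h.args_subset hx, c, ⟨(AF'.mem_of_attacks hbc).2, hc⟩, hxb.tail hbc⟩
    exact ih.tail ((h.attacks_iff hb hc).1 hbc)

/-- An ancestor is alone in its component in both frameworks; a walk from an old non-ancestor never
leaves `AF`. -/
theorem component_right (h : RationalManExpansion AF AF') {x : α} (hx : x ∈ AF.args) :
    AF'.component x = AF.component x := by
  by_cases hanc : x ∈ ancestors AF AF'
  · rw [component_eq_singleton (h.args_subset hx) (h.not_transGen hanc),
      component_eq_singleton hx (h.not_transGen_left hanc)]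
  · ext y
    constructor
    · rintro ⟨hy, hxy, hyx⟩
      have hxy' := h.reflTransGen_left hx hanc hxy
      have hyA := mem_args_of_reflTransGen hx hxy'
      refine ⟨hyA, hxy', h.reflTransGen_left hyA (fun hy' => hanc ?_) hyx⟩
      obtain ⟨_, b, hb, hyb⟩ := hy'
      exact ⟨h.args_subset hx, b, hb, hxy.trans hyb⟩
    · exact fun hy => ⟨h.args_subset hy.1, ReflTransGen.mono h.1.2 _ _ hy.2.1,
        ReflTransGen.mono h.1.2 _ _ hy.2.2⟩

theorem restrict_sccUP (h : RationalManExpansion AF AF') {C E : Set α} (hC : C ⊆ AF.args)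
    (hE : E ⊆ AF.args) :
    AF'.restrict (AF'.sccUP C E) = AF.restrict (AF.sccUP C E) := by
  have hUP : AF'.sccUP C E = AF.sccUP C E := by
    ext x
    rw [mem_sccUP, mem_sccUP]
    exact and_congr_right fun hx => forall_congr' fun b => forall_congr' fun hb =>
      forall_congr' fun _ => not_congr (h.attacks_iff (hE hb) (hC hx))
  have hsub : AF.sccUP C E ⊆ AF.args := sccUP_subset.trans hC
  rw [hUP]
  ext a b
  · exact ⟨fun ha => ⟨hsub ha.2, ha.2⟩, fun ha => ⟨h.args_subset ha.1, ha.2⟩⟩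
  · exact and_congr_left fun hab => h.attacks_iff (hsub hab.1) (hsub hab.2)

theorem exists_sccRecursive_extension (h : RationalManExpansion AF AF') {base : ArgSemantics α}
    (hne : ∀ AF, ∃ E ∈ base AF, E ⊆ AF.args)
    (hb : ∀ (AF : ArgFramework α) (x : α), AF.args = {x} → (∀ a b, ¬ AF.attacks a b) →
      ∀ E ∈ base AF, x ∈ E) {E : Set α} (hE : SCCRecursive base AF E) :
    ∃ E', SCCRecursive base AF' E' ∧ (¬ E' ⊆ AF.args ∨ E' = E) := by
  obtain ⟨E', hE'⟩ := exists_sccRecursive hne AF'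
  by_cases hsub : E' ⊆ AF.args
  swap
  · exact ⟨E', hE', Or.inl hsub⟩
  have hmem' : ∀ x ∈ ancestors AF AF', (x ∈ E' ↔ ∀ y ∈ E', ¬ AF'.attacks y x) :=
    fun x hx => hE'.mem_iff hb hx.1 (h.not_transGen hx)
  have hmem : ∀ x ∈ ancestors AF AF', x ∈ AF.args → (x ∈ E ↔ ∀ y ∈ E, ¬ AF'.attacks y x) := by
    intro x hx hxA
    rw [hE.mem_iff hb hxA (h.not_transGen_left hx)]
    exact forall_congr' fun y => forall_congr' fun hy =>
      not_congr (h.attacks_iff (hE.subset_args hy) hxA).symm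
  have hiff := h.mem_iff_mem (fun x hx hx' => (hmem x hx' (hE.subset_args hx)).1 hx)
    (fun x hx hx' => (hmem' x hx').1 hx)
    (fun x _ hx' hxn => by simpa using mt (hmem' x hx').2 hxn)
    (fun x hx hx' hxn => by simpa using mt (hmem x hx' (hsub hx)).2 hxn)
  refine ⟨E, sccRecursive_of_forall (hE.subset_args.trans h.args_subset) fun C hC => ?_,
    Or.inr rfl⟩
  obtain ⟨x, hxC⟩ := hC.2.1
  have hCx := eq_component_of_mem_sccs hC hxC
  by_cases hxA : x ∈ AF.args
  · rw [h.component_right hxA] at hCx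
    have hC' : C ∈ AF.sccs := hCx ▸ component_mem_sccs hxA
    rw [h.restrict_sccUP hC'.1 hE.subset_args]
    exact hE.forall_sccs hC'
  · have hanc := mem_ancestors_of_new (hC.1 hxC) hxA
    rw [component_eq_singleton (hC.1 hxC) (h.not_transGen hanc)] at hCx
    -- The new component `{x}` is defeated by `E'` through an ancestor shared with `E`, so its
    -- restriction is empty, as is `E ∩ C`.
    obtain ⟨y, hy, hyx⟩ : ∃ y ∈ E', AF'.attacks y x := by
      simpa using mt (hmem' x hanc).2 fun hx => hxA (hsub hx)
    have hyE : y ∈ E := (hiff y (mem_ancestors_of_attacks hanc hyx)).2 hy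
    have hyC : y ∉ C := by
      rw [hCx]
      rintro rfl
      exact hxA (hsub hy)
    have hEC : E ∩ C = ∅ := by
      rw [hCx]
      exact Set.inter_singleton_eq_empty.2 fun hx => hxA (hE.subset_args hx)
    rw [hEC]
    refine sccRecursive_empty (Set.eq_empty_iff_forall_notMem.2 fun z hz => ?_)
    have hz' := mem_sccUP.1 hz.2
    obtain rfl : z = x := by simpa [hCx] using hz'.1
    exact hz'.2 y hyE hyC hyx

end RationalManExpansion

end ArgFramework

theorem mainTheorem2 {α : Type u} (σ : ArgSemantics α)
    (hσ : σ ∈ ({ArgFramework.complete, ArgFramework.preferred, ArgFramework.semiStable,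
      ArgFramework.stage, ArgFramework.stage2, ArgFramework.cf2, ArgFramework.grounded,
      ArgFramework.ideal, ArgFramework.eager} : Set (ArgSemantics α)))
    (AF AF' : ArgFramework α) (hRM : ArgFramework.RationalManExpansion AF AF') :
    ∀ E ∈ σ AF, ∃ E' ∈ σ AF', ¬ (E' ⊆ AF.args) ∨ E' = E := by
  intro E hE
  rcases hσ with rfl | rfl | rfl | rfl | rfl | rfl | rfl | rfl | rfl
  · exact ArgFramework.RationalManExpansion.exists_extension_of_subset_complete
      subset_rfl (ArgFramework.complete_nonempty _)
      (fun _ h₀ hs => (hRM.complete_eq h₀ hs).subset) hE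
  · exact ArgFramework.RationalManExpansion.exists_extension_of_subset_complete
      (ArgFramework.preferred_subset_complete _)
      (ArgFramework.preferred_nonempty _) (fun _ h₀ hs => (hRM.preferred_eq h₀ hs).subset) hE
  · exact ArgFramework.RationalManExpansion.exists_extension_of_subset_complete
      (ArgFramework.semiStable_subset_complete _)
      (ArgFramework.semiStable_nonempty _) (fun _ h₀ hs => (hRM.semiStable_eq h₀ hs).subset) hE
  · exact hRM.exists_stage_extension hE
  · exact hRM.exists_sccRecursive_extension ArgFramework.exists_stage
      ArgFramework.mem_stage_singleton hE
  · exact hRM.exists_sccRecursive_extension ArgFramework.exists_naive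
      ArgFramework.mem_naive_singleton hE
  · exact ArgFramework.RationalManExpansion.exists_extension_of_subset_complete
      (ArgFramework.grounded_subset_complete _)
      (ArgFramework.grounded_nonempty _) (fun _ h₀ hs => (hRM.grounded_eq h₀ hs).subset) hE
  · refine ArgFramework.RationalManExpansion.exists_extension_of_subset_complete
      (ArgFramework.idealFor_subset_complete (ArgFramework.preferred_subset_complete _))
      (ArgFramework.idealFor_nonempty _ _) (fun _ h₀ hs T hT => ?_) hE
    have := hRM.idealFor_subset h₀ hs (ArgFramework.preferred_nonempty AF)
      (ArgFramework.preferred_subset_complete AF) hT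
    rwa [hRM.preferred_eq h₀ hs] at this
  · refine ArgFramework.RationalManExpansion.exists_extension_of_subset_complete
      (ArgFramework.idealFor_subset_complete (ArgFramework.semiStable_subset_complete _))
      (ArgFramework.idealFor_nonempty _ _) (fun _ h₀ hs T hT => ?_) hE
    have := hRM.idealFor_subset h₀ hs (ArgFramework.semiStable_nonempty AF)
      (ArgFramework.semiStable_subset_complete AF) hT
    rwa [hRM.semiStable_eq h₀ hs] at this
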